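/- Let $(G,S)$ be a right-angled Coxeter system with $S$ finite, acting geometrically (properly discontinuously, cocompactly and by isometries) on a proper CAT(0) space $X$, and let $x_0\in X$. Let $\Lambda$ be the Cayley graph of $G$ with respect to $S$. For a geodesic ray $\alpha$ in $\Lambda$ with successive vertices $g_0,g_1,g_2,\dots$, let $\alpha_X$ be the path in $X$ that is the concatenation of the geodesic segments $[g_nx_0,g_{n+1}x_0]$, $n\ge 0$. Say that $\alpha$ $\delta$-tracks a geodesic ray $r:[0,\infty)\to X$ if every point of $\alpha_X$ is within $\delta$ of a point of the image of $r$ and the initial points of $r$ and $\alpha_X$ are within $\delta$ of each other. Then there is a $\delta>0$ such that for every (unit speed) geodesic ray $r:[0,\infty)\to X$ based at $x_0$ there is a geodesic ray $\alpha_r$ in $\Lambda$, starting at the vertex $1_G$, that $\delta$-tracks $r$. Furthermore, for every $A\subseteq S$ the special subgroup $\langle A\rangle$ generated by $A$ is quasi-convex in $X$: there is a $K\ge 0$ such that every geodesic segment of $X$ with both endpoints in the orbit $\langle A\rangle x_0$ lies in the $K$-neighbourhood of $\langle A\rangle x_0$. -/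

import Mathlib

namespace RACG

section Metric

variable {X : Type*} [MetricSpace X]

/-- `c`, restricted to `[0, D]`, is a unit speed geodesic from `x` to `y`. -/
structure IsGeodesic (c : ℝ → X) (D : ℝ) (x y : X) : Prop where
  nonneg : 0 ≤ D
  source : c 0 = x
  target : c D = y
  isometric : ∀ t ∈ Set.Icc 0 D, ∀ t' ∈ Set.Icc 0 D, dist (c t) (c t') = |t - t'|

/-- `c`, restricted to `[0, ∞)`, is a unit speed geodesic ray based at `x`. -/
structure IsGeodesicRay (c : ℝ → X) (x : X) : Prop where
  source : c 0 = x
  isometric : ∀ t ∈ Set.Ici (0 : ℝ), ∀ t' ∈ Set.Ici (0 : ℝ), dist (c t) (c t') = |t - t'|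

/-- The point `p` lies on some geodesic of `X` from `x` to `y`. -/
def OnGeodesic (x y p : X) : Prop :=
  ∃ (c : ℝ → X) (D : ℝ), IsGeodesic c D x y ∧ ∃ t ∈ Set.Icc 0 D, c t = p

variable (X) in
/-- Proper (hence complete) `CAT(0)` spaces. Two points on different sides of a geodesic triangle
lie on two sides that issue from a common vertex, called `a` below; for two points on the same side
the comparison inequality is an equality. -/
structure IsCAT0 : Prop where
  proper : ProperSpace X
  geodesic : ∀ x y : X, ∃ (c : ℝ → X) (D : ℝ), IsGeodesic c D x y
  comparison : ∀ (a b c : X) (γ η : ℝ → X) (D E : ℝ), IsGeodesic γ D a b → IsGeodesic η E a c →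
    ∀ a' b' c' : EuclideanSpace ℝ (Fin 2),
      dist a' b' = dist a b → dist a' c' = dist a c → dist b' c' = dist b c →
    ∀ s ∈ Set.Icc 0 D, ∀ t ∈ Set.Icc 0 E,
    ∀ p' ∈ segment ℝ a' b', ∀ q' ∈ segment ℝ a' c', dist a' p' = s → dist a' q' = t →
      dist (γ s) (η t) ≤ dist p' q'

/-- `Q` is quasi-convex in `X`: for some `K ≥ 0`, every geodesic with endpoints in `Q` lies in the
closed `K`-neighbourhood of `Q`. -/
def IsQuasiConvex (Q : Set X) : Prop :=
  ∃ K : ℝ, 0 ≤ K ∧ ∀ x ∈ Q, ∀ y ∈ Q, ∀ p : X, OnGeodesic x y p → ∃ q ∈ Q, dist p q ≤ K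

end Metric

/-- A geometric action: by isometries, properly discontinuous and cocompact. -/
structure IsGeometricAction (W X : Type*) [Group W] [MetricSpace X] [MulAction W X] : Prop where
  isometric : IsIsometricSMul W X
  properlyDiscontinuous : ProperlyDiscontinuousSMul W X
  cocompact : ∃ K : Set X, IsCompact K ∧ ∀ x : X, ∃ g : W, ∃ k ∈ K, g • k = x

/-- Every `m_{ij}` with `i ≠ j` is `2` or `∞`; Mathlib encodes `∞` as `0`. -/
def IsRightAngled {B : Type*} (M : CoxeterMatrix B) : Prop :=
  ∀ i j : B, i ≠ j → M i j = 2 ∨ M i j = 0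

section Coxeter

variable {B W : Type*} [Group W] {M : CoxeterMatrix B}

/-- The Cayley graph `Λ(W, S)`: `g` and `g * s` are adjacent for `s ∈ S`. -/
def cayleyGraph (cs : CoxeterSystem M W) : SimpleGraph W :=
  SimpleGraph.mulCayley (Set.range cs.simple)

/-- The special subgroup `⟨A⟩`. -/
def specialSubgroup (cs : CoxeterSystem M W) (A : Set B) : Subgroup W :=
  Subgroup.closure (cs.simple '' A)

/-- `α 0, α 1, α 2, …` are the successive vertices of a geodesic ray in the Cayley graph. -/
def IsCayleyRay (cs : CoxeterSystem M W) (α : ℕ → W) : Prop :=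
  ∀ n k : ℕ, (cayleyGraph cs).dist (α n) (α (n + k)) = k

variable {X : Type*} [MetricSpace X] [MulAction W X]

/-- The image of `α_X`: the union of the geodesic segments of `X` joining the consecutive orbit
points `α n • x₀` and `α (n + 1) • x₀`. -/
def pathInSpace (x₀ : X) (α : ℕ → W) : Set X :=
  {p | ∃ n : ℕ, OnGeodesic (α n • x₀) (α (n + 1) • x₀) p}

/-- `α` `δ`-tracks the ray `r`: every point of `α_X` is within `δ` of a point of `r`, and the
initial points of `r` and of `α_X` are within `δ` of each other. -/
def Tracks (x₀ : X) (δ : ℝ) (α : ℕ → W) (r : ℝ → X) : Prop :=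
  (∀ p ∈ pathInSpace x₀ α, ∃ t : ℝ, 0 ≤ t ∧ dist p (r t) ≤ δ) ∧ dist (r 0) (α 0 • x₀) ≤ δ

end Coxeter

end RACG

/-! ### Walls, and the parity with which a group element crosses them. -/

namespace RACG

open List

section Words

variable {B W : Type*} [Group W] {M : CoxeterMatrix B} (cs : CoxeterSystem M W)

/-! A wall is represented by its reflection `t`, and `leftInvSeq` lists the walls that a word
crosses, in order. Sampling a geodesic of `X` at unit steps and choosing nearby orbit points gives a
word that follows the geodesic but need not be reduced.

In a right-angled group a word can be reduced by cancelling pairs of equal letters whose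
intermediate letters all commute with them, so the remaining walls form a subsequence of the old
ones (`exists_sublist_leftInvSeq`). Corresponding vertices of the two words are therefore separated
only by walls that the original word crosses both before and after its vertex (`length_prefix_le`).
The reflection in such a wall moves two points of the geodesic, one on each side, by a bounded
amount. By CAT(0) convexity it also moves the point in between by a bounded amount, so proper
discontinuity leaves boundedly many such walls (`ncard_crossed_twice_le`).

Thus reduced words track geodesic segments uniformly (`exists_isReduced_tracking`). A limit of such
words gives the ray. Quasi-convexity follows because a reduced word for an element of `⟨A⟩` uses
only letters of `A`. -/

theorem leftInvSeq_append (ω₁ ω₂ : List B) :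
    cs.leftInvSeq (ω₁ ++ ω₂) =
      cs.leftInvSeq ω₁ ++ (cs.leftInvSeq ω₂).map (MulAut.conj (cs.wordProd ω₁)) := by
  induction ω₁ with
  | nil => simp [CoxeterSystem.leftInvSeq]
  | cons i ω ih =>
    simp [CoxeterSystem.leftInvSeq, ih, cs.wordProd_cons, Function.comp_def, mul_assoc]

theorem exists_split_of_mem_leftInvSeq {ω : List B} {t : W} (ht : t ∈ cs.leftInvSeq ω) :
    ∃ (p : List B) (i : B) (q : List B), ω = p ++ i :: q ∧
      t = cs.wordProd p * cs.simple i * (cs.wordProd p)⁻¹ := by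
  induction ω generalizing t with
  | nil => simp at ht
  | cons j ω ih =>
    rw [CoxeterSystem.leftInvSeq, mem_cons, mem_map] at ht
    rcases ht with rfl | ⟨u, hu, rfl⟩
    · exact ⟨[], j, ω, by simp⟩
    · obtain ⟨p, i, q, rfl, rfl⟩ := ih hu
      exact ⟨j :: p, i, q, rfl, by simp [cs.wordProd_cons, mul_assoc]⟩

end Words

variable {B W : Type*} [Group W] {M : CoxeterMatrix B}

theorem IsRightAngled.isLiftable (hM : IsRightAngled M) {G : Type*} [Monoid G] (f : B → G)
    (hf : ∀ i, f i * f i = 1) (hc : ∀ i j, i ≠ j → M i j = 2 → Commute (f i) (f j)) :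
    M.IsLiftable f := by
  intro i j
  by_cases hij : i = j
  · subst hij
    simp [hf]
  · rcases hM i j hij with h | h
    · rw [h, (hc i j hij h).mul_pow, pow_two, pow_two, hf, hf, one_mul]
    · rw [h, pow_zero]

variable (cs : CoxeterSystem M W)

theorem commute_of_eq_two {i j : B} (h : M i j = 2) : Commute (cs.simple i) (cs.simple j) := by
  have := cs.simple_mul_simple_pow i j
  rw [h, pow_two] at this
  have h2 := eq_inv_of_mul_eq_one_left this
  simpa [Commute, SemiconjBy] using h2

open Classical in
/-- The indicator function of `u`, with values in `ZMod 2`. -/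
noncomputable def indicatorParity (u t : W) : ZMod 2 := if t = u then 1 else 0

omit [Group W] in
theorem indicatorParity_congr {u t u' t' : W} (h : t = u ↔ t' = u') :
    indicatorParity u t = indicatorParity u' t' := by
  by_cases h' : t = u
  · rw [indicatorParity, indicatorParity, if_pos h', if_pos (h.1 h')]
  · rw [indicatorParity, indicatorParity, if_neg h', if_neg (mt h.2 h')]

/-- Generators act on pairs (group element, parity) by conjugation, and change the parity of
themselves. -/
noncomputable def toggle (i : B) (x : W × ZMod 2) : W × ZMod 2 :=
  (cs.simple i * x.1 * cs.simple i, x.2 + indicatorParity (cs.simple i) x.1)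

theorem simple_conj_eq_iff {i j : B} (h : Commute (cs.simple i) (cs.simple j)) (t : W) :
    cs.simple i * t * cs.simple i = cs.simple j ↔ t = cs.simple j := by
  constructor
  · intro h'
    have := congrArg (fun x => cs.simple i * x * cs.simple i) h'
    simpa [mul_assoc, ← h.eq] using this
  · rintro rfl
    rw [h.eq]; simp [mul_assoc]

theorem toggle_isLiftable (hM : IsRightAngled M) :
    M.IsLiftable (G := Function.End (W × ZMod 2)) (toggle cs) := by
  refine hM.isLiftable _ (fun i => ?_) (fun i j hij h => ?_)
  · funext ⟨t, e⟩
    change toggle cs i (toggle cs i (t, e)) = (t, e)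
    refine Prod.ext (by simp [toggle, mul_assoc]) ?_
    simp only [toggle, add_assoc]
    rw [indicatorParity_congr (simple_conj_eq_iff cs (Commute.refl (cs.simple i)) t),
      CharTwo.add_self_eq_zero, add_zero]
  · have hc := commute_of_eq_two cs h
    funext ⟨t, e⟩
    change toggle cs i (toggle cs j (t, e)) = toggle cs j (toggle cs i (t, e))
    refine Prod.ext ?_ ?_
    · calc _ = (cs.simple i * cs.simple j) * t * (cs.simple j * cs.simple i) := by
            simp only [toggle, mul_assoc]
        _ = (cs.simple j * cs.simple i) * t * (cs.simple i * cs.simple j) := by rw [hc.eq]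
        _ = _ := by simp only [toggle, mul_assoc]
    · simp only [toggle]
      rw [indicatorParity_congr (simple_conj_eq_iff cs hc t),
        indicatorParity_congr (simple_conj_eq_iff cs hc.symm t), add_right_comm]

/-- The action of the group on pairs (group element, parity) that extends `toggle`. -/
noncomputable def toggleHom (hM : IsRightAngled M) : W →* Function.End (W × ZMod 2) :=
  cs.lift ⟨toggle cs, toggle_isLiftable cs hM⟩

/-- The parity of the number of times that a path from `1` to `w` crosses the wall of `t`. -/
noncomputable def crossing (hM : IsRightAngled M) (w t : W) : ZMod 2 :=
  (toggleHom cs hM w⁻¹ (t, 0)).2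

variable (hM : IsRightAngled M)

theorem toggleHom_mul_apply (w w' : W) (x : W × ZMod 2) :
    toggleHom cs hM (w * w') x = toggleHom cs hM w (toggleHom cs hM w' x) := by
  rw [map_mul]; rfl

theorem toggleHom_simple_apply (i : B) (x : W × ZMod 2) :
    toggleHom cs hM (cs.simple i) x = toggle cs i x :=
  congrFun (cs.lift_apply_simple (toggle_isLiftable cs hM) i) x

theorem toggleHom_one_apply (x : W × ZMod 2) : toggleHom cs hM 1 x = x := by
  rw [map_one]; rfl

theorem toggleHom_apply (w t : W) (e : ZMod 2) :
    toggleHom cs hM w (t, e) = (w * t * w⁻¹, e + crossing cs hM w⁻¹ t) := by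
  rw [crossing, inv_inv]
  induction w using cs.simple_induction_left generalizing t e with
  | one => simp [toggleHom_one_apply]
  | mul_simple_left w i ih =>
    rw [toggleHom_mul_apply, toggleHom_mul_apply, ih t e, ih t 0, toggleHom_simple_apply,
      toggleHom_simple_apply]
    simp only [toggle, mul_inv_rev, cs.inv_simple, mul_assoc, add_assoc, zero_add]

theorem crossing_mul (w w' t : W) :
    crossing cs hM (w * w') t = crossing cs hM w t + crossing cs hM w' (w⁻¹ * t * w) := by
  conv_lhs => rw [crossing, mul_inv_rev, toggleHom_mul_apply, toggleHom_apply, toggleHom_apply]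
  simp

theorem crossing_one (t : W) : crossing cs hM 1 t = 0 := by
  simp [crossing, toggleHom_one_apply]

theorem crossing_simple (i : B) (t : W) :
    crossing cs hM (cs.simple i) t = indicatorParity (cs.simple i) t := by
  rw [crossing, cs.inv_simple, toggleHom_simple_apply, toggle, zero_add]

theorem crossing_inv (w t : W) :
    crossing cs hM w⁻¹ t = crossing cs hM w (w * t * w⁻¹) := by
  have h := crossing_mul cs hM w w⁻¹ (w * t * w⁻¹)
  rw [mul_inv_cancel, crossing_one] at h
  have h2 : w⁻¹ * (w * t * w⁻¹) * w = t := by group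
  rw [h2] at h
  exact ((CharTwo.add_eq_zero).1 h.symm).symm

open Classical in
-- The left side depends only on the group element, so all words for it cross a given wall with the
-- same parity.
theorem crossing_wordProd (ω : List B) (t : W) :
    crossing cs hM (cs.wordProd ω) t = ((cs.leftInvSeq ω).count t : ZMod 2) := by
  induction ω generalizing t with
  | nil => simp [crossing_one]
  | cons i ω ih =>
    rw [cs.wordProd_cons, crossing_mul, ih, crossing_simple, CoxeterSystem.leftInvSeq, count_cons]
    have h : t = MulAut.conj (cs.simple i) ((cs.simple i)⁻¹ * t * cs.simple i) := by
      simp [mul_assoc]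
    conv_rhs => rw [h]
    rw [count_map_of_injective _ _ (MulAut.conj (cs.simple i)).injective, ← h]
    by_cases h' : t = cs.simple i
    · simp [h', add_comm, indicatorParity]
    · simp [h', Ne.symm h', indicatorParity]

theorem mem_leftInvSeq_of_crossing_ne_zero {ω : List B} {t : W}
    (h : crossing cs hM (cs.wordProd ω) t ≠ 0) : t ∈ cs.leftInvSeq ω := by
  classical
  rw [crossing_wordProd] at h
  by_contra hn
  rw [count_eq_zero_of_not_mem hn] at h
  simp at h

theorem crossing_eq_one_of_mem {ω : List B} (hω : (cs.leftInvSeq ω).Nodup) {t : W}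
    (h : t ∈ cs.leftInvSeq ω) : crossing cs hM (cs.wordProd ω) t = 1 := by
  classical
  rw [crossing_wordProd, count_eq_one_of_mem hω h, Nat.cast_one]

theorem setOf_crossing_wordProd {ω : List B} (hω : (cs.leftInvSeq ω).Nodup) :
    {t | crossing cs hM (cs.wordProd ω) t = 1} = {t | t ∈ cs.leftInvSeq ω} :=
  Set.ext fun t => ⟨fun h => mem_leftInvSeq_of_crossing_ne_zero cs hM
    (by rw [show crossing cs hM (cs.wordProd ω) t = 1 from h]; exact one_ne_zero),
    crossing_eq_one_of_mem cs hM hω⟩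

theorem ncard_crossing_wordProd {ω : List B} (hω : (cs.leftInvSeq ω).Nodup) :
    {t | crossing cs hM (cs.wordProd ω) t = 1}.ncard = ω.length := by
  classical
  rw [setOf_crossing_wordProd cs hM hω, ← cs.length_leftInvSeq ω, ← toFinset_card_of_nodup hω,
    ← Set.ncard_coe_finset]
  congr 1
  ext t
  simp

theorem ncard_crossing (w : W) : {t | crossing cs hM w t = 1}.ncard = cs.length w := by
  obtain ⟨ω, hω, rfl⟩ := cs.exists_isReduced w
  rw [ncard_crossing_wordProd cs hM hω.nodup_leftInvSeq, hω.eq]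

include hM in
theorem isReduced_of_nodup_leftInvSeq {ω : List B} (hω : (cs.leftInvSeq ω).Nodup) :
    cs.IsReduced ω := by
  rw [CoxeterSystem.IsReduced, ← ncard_crossing cs hM, ncard_crossing_wordProd cs hM hω]

theorem length_mul_lt_of_crossing_ne_zero {w t : W} (h : crossing cs hM w t ≠ 0) :
    cs.length (t * w) < cs.length w := by
  obtain ⟨ω, hω, rfl⟩ := cs.exists_isReduced w
  exact (cs.isLeftInversion_of_mem_leftInvSeq hω (mem_leftInvSeq_of_crossing_ne_zero cs hM h)).2

include hM in
-- The parity of the number of letters `i` is a homomorphism to an abelian group, hence invariant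
-- under conjugation.
theorem eq_of_conj_simple {w : W} {i j : B} (h : w * cs.simple i * w⁻¹ = cs.simple j) :
    i = j := by
  classical
  let f : B → Multiplicative (ZMod 2) := fun a => Multiplicative.ofAdd (if a = i then 1 else 0)
  have hf : M.IsLiftable f := by
    refine hM.isLiftable f (fun a => ?_) (fun a b _ _ => Commute.all _ _)
    simp only [f, ← ofAdd_add, CharTwo.add_self_eq_zero, ofAdd_zero]
  have h' := congrArg (cs.lift ⟨f, hf⟩) h
  rw [map_mul, map_mul, map_inv, mul_comm, inv_mul_cancel_left, cs.lift_apply_simple hf,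
    cs.lift_apply_simple hf] at h'
  by_contra hij
  simp [f, Ne.symm hij] at h'

include hM in
-- Killing all other generators maps the group to the infinite dihedral group `DihedralGroup 0`,
-- where the product of the two reflections is a translation.
theorem zpow_simple_mul_simple_eq_one {i j : B} (hij : i ≠ j) (h0 : M i j = 0) {k : ℤ}
    (hk : (cs.simple i * cs.simple j) ^ k = 1) : k = 0 := by
  classical
  let f : B → DihedralGroup 0 := fun a =>
    if a = i then .sr 0 else if a = j then .sr 1 else 1
  have hf : M.IsLiftable f := by
    refine hM.isLiftable f (fun a => ?_) (fun a b hab h2 => ?_)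
    · simp only [f]
      split_ifs <;> simp
    · have hs : M b a = 2 := by rw [M.symmetric]; exact h2
      simp only [f]
      split_ifs <;> subst_vars <;> first | contradiction | simp_all
  have h' := congrArg (cs.lift ⟨f, hf⟩) hk
  rw [map_zpow, map_mul, cs.lift_apply_simple hf, cs.lift_apply_simple hf, map_one] at h'
  simp only [f, if_true, if_neg hij.symm, DihedralGroup.sr_mul_sr, sub_zero,
    DihedralGroup.r_zpow, DihedralGroup.one_def, DihedralGroup.r.injEq] at h'
  simpa using h'

end RACG

/-! ### Reducing words by deleting repeated walls. -/

namespace RACG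

open List

variable {B W : Type*} [Group W] {M : CoxeterMatrix B} (cs : CoxeterSystem M W)
variable (hM : IsRightAngled M)

/-- The crossing parity for the left product with a generator. -/
theorem crossing_simple_mul (i : B) (w t : W) :
    crossing cs hM (cs.simple i * w) t =
      indicatorParity (cs.simple i) t + crossing cs hM w (cs.simple i * t * cs.simple i) := by
  rw [crossing_mul, crossing_simple, cs.inv_simple]

section Dihedral

variable {i j : B}

theorem simple_conj_zpow_left (k : ℤ) :
    cs.simple i * ((cs.simple i * cs.simple j) ^ k * cs.simple i) * cs.simple i =
      (cs.simple i * cs.simple j) ^ (-k) * cs.simple i := by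
  have h : cs.simple i * (cs.simple i * cs.simple j) * (cs.simple i)⁻¹ =
      (cs.simple i * cs.simple j)⁻¹ := by simp
  have h2 := conj_zpow (i := k) (a := cs.simple i) (b := cs.simple i * cs.simple j)
  rw [h, cs.inv_simple, inv_zpow'] at h2
  rw [h2]
  simp [mul_assoc]

theorem simple_conj_zpow_right (k : ℤ) :
    cs.simple j * ((cs.simple i * cs.simple j) ^ k * cs.simple i) * cs.simple j =
      (cs.simple i * cs.simple j) ^ (-k - 2) * cs.simple i := by
  have h : cs.simple j * (cs.simple i * cs.simple j) * (cs.simple j)⁻¹ =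
      (cs.simple i * cs.simple j)⁻¹ := by simp [mul_assoc]
  have h2 := conj_zpow (i := k) (a := cs.simple j) (b := cs.simple i * cs.simple j)
  rw [h, cs.inv_simple, inv_zpow'] at h2
  rw [zpow_sub, h2, zpow_ofNat, pow_two]
  simp [mul_assoc]

/-- Among the reflections of an infinite dihedral special subgroup, which form a line, those
that invert `w` form an interval that starts at the base point. -/
def InvertsInterval (i j : B) (w : W) : Prop :=
  ∃ n : ℤ, ∀ k : ℤ, crossing cs hM w ((cs.simple i * cs.simple j) ^ k * cs.simple i) =
    if (0 ≤ k ∧ k < n) ∨ (n ≤ k ∧ k < 0) then 1 else 0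

variable {cs hM}

theorem InvertsInterval.left_mul (hij : i ≠ j) (h0 : M i j = 0) {w : W}
    (h : InvertsInterval cs hM i j w) : InvertsInterval cs hM i j (cs.simple i * w) := by
  obtain ⟨n, hn⟩ := h
  -- Conjugation by `cs.simple i` is the reflection `k ↦ -k` of the line of walls, and the wall `k =
  -- 0` is toggled.
  refine ⟨1 - n, fun k => ?_⟩
  rw [crossing_simple_mul, simple_conj_zpow_left, hn, indicatorParity]
  have : (cs.simple i * cs.simple j) ^ k * cs.simple i = cs.simple i ↔ k = 0 := by
    constructor
    · intro h
      exact zpow_simple_mul_simple_eq_one cs hM hij h0 (mul_eq_right.1 h)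
    · rintro rfl; simp
  split_ifs <;> first | rfl | (exfalso; rw [this] at *; omega)

theorem InvertsInterval.right_mul (hij : i ≠ j) (h0 : M i j = 0) {w : W}
    (h : InvertsInterval cs hM i j w) : InvertsInterval cs hM i j (cs.simple j * w) := by
  obtain ⟨n, hn⟩ := h
  -- Here the reflection of the line is `k ↦ -k - 2`, and the toggled wall is `k = -1`.
  refine ⟨-1 - n, fun k => ?_⟩
  rw [crossing_simple_mul, simple_conj_zpow_right, hn, indicatorParity]
  have : (cs.simple i * cs.simple j) ^ k * cs.simple i = cs.simple j ↔ k = -1 := by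
    constructor
    · intro h
      have : k + 1 = 0 := by
        refine zpow_simple_mul_simple_eq_one cs hM hij h0 ?_
        rw [zpow_add_one, ← mul_assoc, h, cs.simple_mul_simple_self]
      omega
    · rintro rfl; simp
  split_ifs <;> first | rfl | (exfalso; rw [this] at *; omega)

theorem InvertsInterval.zpow_mul (hij : i ≠ j) (h0 : M i j = 0) (k : ℤ) {w : W}
    (h : InvertsInterval cs hM i j w) :
    InvertsInterval cs hM i j ((cs.simple i * cs.simple j) ^ k * w) := by
  induction k using Int.induction_on with
  | zero => simpa using h
  | succ k ih =>
    rw [add_comm, zpow_add, zpow_one, mul_assoc, mul_assoc]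
    exact (ih.right_mul hij h0).left_mul hij h0
  | pred k ih =>
    rw [sub_eq_add_neg, add_comm, zpow_add, zpow_neg_one, mul_inv_rev, cs.inv_simple,
      cs.inv_simple, mul_assoc, mul_assoc]
    exact (ih.left_mul hij h0).right_mul hij h0

variable (cs hM) in
-- Multiplying by the reflection in a crossed wall of the line shortens `w`, and left multiplication
-- by dihedral elements preserves the interval property. Induction on length reduces to the case in
-- which no wall of the line is crossed.
theorem invertsInterval (hij : i ≠ j) (h0 : M i j = 0) (w : W) :
    InvertsInterval cs hM i j w := by
  induction hw : cs.length w using Nat.strong_induction_on generalizing w with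
  | _ n ih =>
    subst hw
    by_cases h : ∃ k : ℤ,
        crossing cs hM w ((cs.simple i * cs.simple j) ^ k * cs.simple i) ≠ 0
    · obtain ⟨k, hk⟩ := h
      have h1 := ih _ (length_mul_lt_of_crossing_ne_zero cs hM hk) _ rfl
      have h2 := (h1.zpow_mul hij h0 (-k)).left_mul hij h0
      have : cs.simple i * ((cs.simple i * cs.simple j) ^ (-k) *
          ((cs.simple i * cs.simple j) ^ k * cs.simple i * w)) = w := by
        rw [zpow_neg, mul_assoc, inv_mul_cancel_left, cs.simple_mul_simple_cancel_left]
      rwa [this] at h2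
    · push Not at h
      refine ⟨0, fun k => ?_⟩
      rw [h k, if_neg (by omega)]

end Dihedral

/-- If `w` commutes with a generator, so do the generators that invert `w`. -/
theorem commute_of_crossing {w : W} {i j : B} (hw : Commute w (cs.simple i))
    (hj : crossing cs hM w (cs.simple j) ≠ 0) : Commute (cs.simple j) (cs.simple i) := by
  rcases eq_or_ne i j with rfl | hij
  · exact Commute.refl _
  rcases hM i j hij with h2 | h0
  · exact (commute_of_eq_two cs h2).symm
  exfalso
  -- The base point lies between the walls `-1` (that of `j`) and `0` (that of `i`). Commutation
  -- with `cs.simple i` makes `w` cross wall `1` as well as wall `-1`, but no interval starting at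
  -- the base point contains both.
  obtain ⟨n, hn⟩ := invertsInterval cs hM hij h0 w
  have hm := hn (-1)
  rw [zpow_neg_one, mul_inv_rev, cs.inv_simple, cs.inv_simple,
    cs.simple_mul_simple_cancel_right] at hm
  have hp := hn 1
  rw [zpow_one] at hp
  have key : crossing cs hM w (cs.simple i * cs.simple j * cs.simple i) =
      crossing cs hM w (cs.simple j) := by
    have h := crossing_simple_mul cs hM i w (cs.simple j)
    rw [← hw.eq, crossing_mul, crossing_simple, add_comm] at h
    have h3 : indicatorParity (cs.simple i) (w⁻¹ * cs.simple j * w) =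
        indicatorParity (cs.simple i) (cs.simple j) := by
      apply indicatorParity_congr
      rw [mul_assoc, inv_mul_eq_iff_eq_mul, hw.eq, mul_left_inj]
    rw [h3] at h
    exact (add_left_cancel h).symm
  rw [key, hm] at hp
  rw [hm] at hj
  split_ifs at * <;> first | omega | simp_all

include hM in
-- The wall of the first letter is crossed, so that letter commutes with `cs.simple i`; stripping it
-- preserves the assumptions.
theorem commute_of_mem {i : B} {ω : List B} (hω : (cs.leftInvSeq ω).Nodup)
    (hi : cs.simple i ∉ cs.leftInvSeq ω) (hc : Commute (cs.wordProd ω) (cs.simple i)) :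
    ∀ a ∈ ω, Commute (cs.simple a) (cs.simple i) := by
  induction ω with
  | nil => simp
  | cons b ω ih =>
    have hb : Commute (cs.simple b) (cs.simple i) :=
      commute_of_crossing cs hM hc (by
        rw [crossing_eq_one_of_mem cs hM hω (by simp [CoxeterSystem.leftInvSeq])]
        exact one_ne_zero)
    rw [cs.wordProd_cons] at hc
    rw [CoxeterSystem.leftInvSeq] at hω hi
    rw [nodup_cons] at hω
    rw [mem_cons, not_or, mem_map] at hi
    intro a ha
    rcases mem_cons.1 ha with rfl | ha
    · exact hb
    refine ih (Nodup.of_map _ hω.2) (fun h => hi.2 ⟨_, h, ?_⟩) ?_ a ha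
    · rw [MulAut.conj_apply, hb.eq, mul_inv_cancel_right]
    · have := (hb.inv_left).mul_left hc
      rwa [inv_mul_cancel_left] at this

include hM in
/-- Every word can be shortened to a word for the same element that crosses every wall at most
once, in such a way that the sequence of walls shrinks to a subsequence. -/
theorem exists_sublist_leftInvSeq (ω : List B) : ∃ ω' : List B,
    cs.wordProd ω' = cs.wordProd ω ∧ (cs.leftInvSeq ω').Nodup ∧
      (cs.leftInvSeq ω').Sublist (cs.leftInvSeq ω) := by
  induction ω using List.reverseRecOn with
  | nil => exact ⟨[], by simp⟩
  | append_singleton ω i ih =>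
    obtain ⟨ω', hp, hn, hs⟩ := ih
    have hl : ∀ v : List B, cs.leftInvSeq (v ++ [i]) =
        cs.leftInvSeq v ++ [cs.wordProd v * cs.simple i * (cs.wordProd v)⁻¹] := by
      intro v; simp [leftInvSeq_append]
    by_cases ht : cs.wordProd ω' * cs.simple i * (cs.wordProd ω')⁻¹ ∈ cs.leftInvSeq ω'
    -- The new letter recrosses the wall of an earlier letter `j`. Then `j = i`, every letter of `z`
    -- commutes with it, and `p i z i` equals `p z`.
    · obtain ⟨p, j, z, rfl, h⟩ := exists_split_of_mem_leftInvSeq cs ht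
      have hz : cs.wordProd z * cs.simple i * (cs.wordProd z)⁻¹ = cs.simple j := by
        rw [cs.wordProd_append, cs.wordProd_cons] at h
        have := congrArg
          (fun x => cs.simple j * ((cs.wordProd p)⁻¹ * x * cs.wordProd p) * cs.simple j) h
        simpa [mul_assoc] using this
      obtain rfl := eq_of_conj_simple cs hM hz
      have hc : Commute (cs.wordProd z) (cs.simple i) := mul_inv_eq_iff_eq_mul.1 hz
      rw [leftInvSeq_append, CoxeterSystem.leftInvSeq, nodup_append] at hn
      have hn' := Nodup.of_map _ hn.2.1
      rw [nodup_cons] at hn'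
      have hnz := Nodup.of_map _ hn'.2
      have hiz : cs.simple i ∉ cs.leftInvSeq z := fun h =>
        hn'.1 (mem_map.2 ⟨_, h, by simp⟩)
      have hcz := commute_of_mem cs hM hnz hiz hc
      -- Deleting the letter before `z` leaves the walls crossed along `z` unchanged.
      have hmap : (cs.leftInvSeq z).map (MulAut.conj (cs.simple i)) = cs.leftInvSeq z := by
        conv_rhs => rw [← map_id (cs.leftInvSeq z)]
        refine map_congr_left fun t ht => ?_
        obtain ⟨q, a, q', rfl, rfl⟩ := exists_split_of_mem_leftInvSeq cs ht
        have hq : Commute (cs.wordProd q) (cs.simple i) := by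
          refine Commute.list_prod_left _ _ fun x hx => ?_
          obtain ⟨b, hb, rfl⟩ := mem_map.1 hx
          exact hcz b (by simp [hb])
        have := (hq.mul_left (hcz a (by simp))).mul_left hq.inv_left
        rw [MulAut.conj_apply, ← this.eq, mul_inv_cancel_right, id]
      have hsub : (cs.leftInvSeq (p ++ z)).Sublist (cs.leftInvSeq (p ++ i :: z)) := by
        rw [leftInvSeq_append, leftInvSeq_append, CoxeterSystem.leftInvSeq, hmap]
        exact (Sublist.refl _).append ((sublist_cons_self _ _).map _)
      refine ⟨p ++ z, ?_, ?_, ?_⟩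
      · rw [cs.wordProd_append, cs.wordProd_append, ← hp, cs.wordProd_append, cs.wordProd_cons,
          cs.wordProd_singleton, ← hc.eq]
        simp [mul_assoc]
      · refine Nodup.sublist hsub ?_
        rwa [leftInvSeq_append, CoxeterSystem.leftInvSeq, nodup_append]
      · rw [hl]
        exact (hsub.trans hs).trans (sublist_append_left _ _)
    · refine ⟨ω' ++ [i], by simp [cs.wordProd_append, hp], ?_, ?_⟩
      · rw [hl, nodup_append]
        refine ⟨hn, by simp, ?_⟩
        rintro a ha b hb rfl
        exact ht (by rwa [mem_singleton.1 hb] at ha)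
      · rw [hl, hl, hp]
        exact hs.append (Sublist.refl _)

/-- Word distance counts separating walls; conjugation by `w` carries the walls crossed by `w⁻¹ *
w'` to those that separate `w` from `w'`. -/
theorem length_inv_mul (w w' : W) : cs.length (w⁻¹ * w') =
    {t | crossing cs hM w t + crossing cs hM w' t = 1}.ncard := by
  rw [← ncard_crossing cs hM]
  refine Set.ncard_congr (fun t _ => w * t * w⁻¹) ?_ ?_ ?_
  · intro t ht
    rwa [Set.mem_ofPred_eq, crossing_mul, crossing_inv, inv_inv] at ht
  · intro a b _ _ h
    exact mul_left_cancel (mul_right_cancel h)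
  · intro t ht
    refine ⟨w⁻¹ * t * w, ?_, by group⟩
    rw [Set.mem_ofPred_eq, crossing_mul, crossing_inv, inv_inv]
    have : w * (w⁻¹ * t * w) * w⁻¹ = t := by group
    rwa [this]

include hM in
/-- If the walls crossed by two words for the same element are split in a compatible way, the
distance of the corresponding vertices is at most the number of walls that one of the words
crosses both before and after its vertex. -/
theorem length_prefix_le {ω ω' : List B} (hp : cs.wordProd ω' = cs.wordProd ω) {k k' : ℕ}
    (h1 : ((cs.leftInvSeq ω').take k').Sublist ((cs.leftInvSeq ω).take k))
    (h2 : ((cs.leftInvSeq ω').drop k').Sublist ((cs.leftInvSeq ω).drop k)) :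
    cs.length ((cs.wordProd (ω.take k))⁻¹ * cs.wordProd (ω'.take k')) ≤
      {t | t ∈ (cs.leftInvSeq ω).take k ∧ t ∈ (cs.leftInvSeq ω).drop k}.ncard := by
  classical
  rw [length_inv_mul cs hM]
  refine Set.ncard_le_ncard (fun t ht => ?_)
    (((cs.leftInvSeq ω).take k).finite_toSet.subset fun t ht => ht.1)
  -- The total parities of the two words agree. A wall absent from the first part of `ω` is absent
  -- from both first parts; one absent from the second part is absent from both second parts, so the
  -- first parts have equal parity. Neither kind separates the vertices.
  have hcount := congrArg (fun w => crossing cs hM w t) hp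
  simp only [crossing_wordProd] at hcount
  rw [← take_append_drop k (cs.leftInvSeq ω), ← take_append_drop k' (cs.leftInvSeq ω'),
    count_append, count_append] at hcount
  rw [Set.mem_ofPred_eq, crossing_wordProd, crossing_wordProd, cs.leftInvSeq_take,
    cs.leftInvSeq_take] at ht
  constructor
  · by_contra hn
    rw [count_eq_zero_of_not_mem hn, count_eq_zero_of_not_mem (fun h => hn (h1.subset h))] at ht
    simp at ht
  · by_contra hn
    rw [count_eq_zero_of_not_mem hn, count_eq_zero_of_not_mem (fun h => hn (h2.subset h))]
      at hcount
    simp only [add_zero] at hcount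
    rw [hcount, CharTwo.add_self_eq_zero] at ht
    exact zero_ne_one ht

include hM in
-- A sublist relation can be split at any cut of either list, which pairs each vertex of one word
-- with a vertex of the other.
theorem exists_isReduced_near (ω : List B) : ∃ ω' : List B,
    cs.wordProd ω' = cs.wordProd ω ∧ cs.IsReduced ω' ∧
    (∀ k, ∃ k', cs.length ((cs.wordProd (ω.take k))⁻¹ * cs.wordProd (ω'.take k')) ≤
      {t | t ∈ (cs.leftInvSeq ω).take k ∧ t ∈ (cs.leftInvSeq ω).drop k}.ncard) ∧
    (∀ k', ∃ k, cs.length ((cs.wordProd (ω.take k))⁻¹ * cs.wordProd (ω'.take k')) ≤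
      {t | t ∈ (cs.leftInvSeq ω).take k ∧ t ∈ (cs.leftInvSeq ω).drop k}.ncard) := by
  obtain ⟨ω', hp, hn, hs⟩ := exists_sublist_leftInvSeq cs hM ω
  refine ⟨ω', hp, isReduced_of_nodup_leftInvSeq cs hM hn, fun k => ?_, fun k' => ?_⟩
  · rw [← take_append_drop k (cs.leftInvSeq ω), sublist_append_iff] at hs
    obtain ⟨l₁, l₂, hl, h1, h2⟩ := hs
    exact ⟨l₁.length, length_prefix_le cs hM hp (by simpa [hl] using h1)
      (by simpa [hl] using h2)⟩
  · rw [← take_append_drop k' (cs.leftInvSeq ω'), append_sublist_iff] at hs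
    obtain ⟨r₁, r₂, hr, h1, h2⟩ := hs
    exact ⟨r₁.length, length_prefix_le cs hM hp (by simpa [hr] using h1)
      (by simpa [hr] using h2)⟩

include hM in
-- Killing the generators outside `A` is a retraction onto `⟨A⟩`. It fixes the element and erases
-- the letters outside `A`, so a reduced word has none.
theorem mem_of_mem_isReduced {A : Set B} {ω : List B} (hω : cs.IsReduced ω)
    (hA : cs.wordProd ω ∈ specialSubgroup cs A) : ∀ a ∈ ω, a ∈ A := by
  classical
  let f : B → W := fun a => if a ∈ A then cs.simple a else 1
  have hf : M.IsLiftable f := by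
    refine hM.isLiftable f (fun a => ?_) (fun a b _ h => ?_)
    · simp only [f]; split_ifs <;> simp
    · simp only [f]
      have := commute_of_eq_two cs h
      split_ifs <;> simp [this]
  let ρ : W →* W := cs.lift ⟨f, hf⟩
  have hρA : ∀ w ∈ specialSubgroup cs A, ρ w = w := by
    intro w hw
    induction hw using Subgroup.closure_induction with
    | mem x hx =>
      obtain ⟨a, ha, rfl⟩ := hx
      simp [ρ, cs.lift_apply_simple hf, f, ha]
    | one => simp
    | mul x y _ _ hx hy => rw [map_mul, hx, hy]
    | inv x _ hx => rw [map_inv, hx]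
  have hρ : ∀ v : List B, ρ (cs.wordProd v) = cs.wordProd (v.filter (· ∈ A)) := by
    intro v
    induction v with
    | nil => simp
    | cons a v ih =>
      rw [cs.wordProd_cons, map_mul, ih, filter_cons]
      by_cases ha : a ∈ A <;> simp [ρ, cs.lift_apply_simple hf, f, ha, cs.wordProd_cons]
  have h := hρ ω
  rw [hρA _ hA] at h
  have hlen : ω.length ≤ (ω.filter (· ∈ A)).length := by
    rw [← hω.eq, h]
    exact cs.length_wordProd_le _
  have heq := filter_sublist.eq_of_length_le hlen
  intro a ha
  rw [← heq] at ha
  simpa using (mem_filter.1 ha).2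

theorem wordProd_mem_specialSubgroup {A : Set B} {ω : List B} (h : ∀ a ∈ ω, a ∈ A) :
    cs.wordProd ω ∈ specialSubgroup cs A := by
  refine Subgroup.list_prod_mem _ fun x hx => ?_
  obtain ⟨a, ha, rfl⟩ := mem_map.1 hx
  exact Subgroup.subset_closure ⟨a, h a ha, rfl⟩

end RACG

/-! ### The word metric and interpolation by words. -/

namespace RACG

open List

section CayleyGraph

variable {B W : Type*} [Group W] {M : CoxeterMatrix B} (cs : CoxeterSystem M W)

theorem length_le_walk_length {g h : W} (p : (cayleyGraph cs).Walk g h) :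
    cs.length (g⁻¹ * h) ≤ p.length := by
  induction p with
  | nil => simp
  | @cons u v w huv p ih =>
    obtain ⟨-, s, ⟨i, rfl⟩, hs⟩ := (SimpleGraph.mulCayley_adj' _ _ _).1 huv
    have h1 : u⁻¹ * v = cs.simple i := by
      rcases hs with hs | hs
      · rw [← hs, inv_mul_cancel_left]
      · rw [hs, mul_inv_rev, inv_mul_cancel_right, cs.inv_simple]
    calc cs.length (u⁻¹ * w) = cs.length ((u⁻¹ * v) * (v⁻¹ * w)) := by
          rw [mul_assoc, mul_inv_cancel_left]
      _ ≤ cs.length (u⁻¹ * v) + cs.length (v⁻¹ * w) := cs.length_mul_le _ _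
      _ ≤ _ := by rw [h1, cs.length_simple, SimpleGraph.Walk.length_cons]; omega

theorem exists_walk (g : W) (ω : List B) :
    ∃ p : (cayleyGraph cs).Walk g (g * cs.wordProd ω), p.length = ω.length := by
  induction ω generalizing g with
  | nil =>
    rw [cs.wordProd_nil, mul_one]
    exact ⟨SimpleGraph.Walk.nil, rfl⟩
  | cons i ω ih =>
    obtain ⟨p, hp⟩ := ih (g * cs.simple i)
    rw [cs.wordProd_cons, ← mul_assoc]
    have hadj : (cayleyGraph cs).Adj g (g * cs.simple i) := by
      refine (SimpleGraph.mulCayley_adj' _ _ _).2 ⟨fun h => ?_, _, ⟨i, rfl⟩, Or.inl rfl⟩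
      have h1 := cs.length_simple i
      rw [left_eq_mul.1 h, cs.length_one] at h1
      exact zero_ne_one h1
    exact ⟨SimpleGraph.Walk.cons hadj p, by simp [hp]⟩

theorem cayleyGraph_dist (g h : W) : (cayleyGraph cs).dist g h = cs.length (g⁻¹ * h) := by
  obtain ⟨ω, hω, hgh⟩ := cs.exists_isReduced (g⁻¹ * h)
  have hw := exists_walk cs g ω
  rw [← hgh, mul_inv_cancel_left] at hw
  obtain ⟨p, hp⟩ := hw
  apply le_antisymm
  · rw [hgh, hω.eq, ← hp]
    exact SimpleGraph.dist_le p
  · obtain ⟨q, hq⟩ := SimpleGraph.Reachable.exists_walk_length_eq_dist ⟨p⟩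
    rw [← hq]
    exact length_le_walk_length cs q

/-- A sequence of group elements with bounded jumps is interpolated by a word. -/
theorem exists_word_interpolating {L : ℕ} {u : ℕ → W} (h0 : u 0 = 1)
    (hu : ∀ i, cs.length ((u i)⁻¹ * u (i + 1)) ≤ L) (m : ℕ) :
    ∃ (ω : List B) (σ : ℕ → ℕ), cs.wordProd ω = u m ∧ Monotone σ ∧ (∀ k, σ k ≤ m) ∧
      (∀ k, cs.length ((cs.wordProd (ω.take k))⁻¹ * u (σ k)) ≤ L) ∧
      ∀ i ≤ m, ∃ k, cs.wordProd (ω.take k) = u i := by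
  induction m with
  | zero =>
    refine ⟨[], fun _ => 0, by simp [h0], monotone_const, by simp, by simp [h0], ?_⟩
    intro i hi
    obtain rfl : i = 0 := by omega
    exact ⟨0, by simp [h0]⟩
  | succ m ih =>
    obtain ⟨ω, σ, hω, hσ, hσm, hL, hs⟩ := ih
    obtain ⟨v, hv, hvu⟩ := cs.exists_isReduced ((u m)⁻¹ * u (m + 1))
    have hvL : v.length ≤ L := by rw [← hv.eq, ← hvu]; exact hu m
    -- Inside `v` the index is already `m + 1`: at most `L` letters remain before `u (m + 1)`.
    refine ⟨ω ++ v, fun k => if k ≤ ω.length then σ k else m + 1, ?_, ?_, ?_, ?_, ?_⟩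
    · rw [cs.wordProd_append, hω, ← hvu, mul_inv_cancel_left]
    · intro a b hab
      have := hσ hab
      have := hσm a
      simp only
      split_ifs <;> omega
    · intro k
      have := hσm k
      simp only
      split_ifs <;> omega
    · intro k
      simp only
      split_ifs with hk
      · rw [take_append_of_le_length hk]
        exact hL k
      · have h1 : (ω ++ v).take k = ω ++ v.take (k - ω.length) := by
          rw [take_append, take_of_length_le (by omega)]
        have h2 : (cs.wordProd ((ω ++ v).take k))⁻¹ * u (m + 1) =
            cs.wordProd (v.drop (k - ω.length)) := by
          rw [h1, cs.wordProd_append, hω, mul_inv_rev, mul_assoc, hvu,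
            inv_mul_eq_iff_eq_mul, ← cs.wordProd_append, take_append_drop]
        rw [h2]
        refine (cs.length_wordProd_le _).trans ?_
        rw [length_drop]
        omega
    · intro i hi
      rcases Nat.le_succ_iff.1 hi with hi | rfl
      · obtain ⟨k, hk⟩ := hs i hi
        -- A cut beyond the end of `ω` would now run into `v`.
        refine ⟨min k ω.length, ?_⟩
        rw [take_append_of_le_length (min_le_right _ _), ← hk]
        congr 1
        rcases le_total k ω.length with h | h
        · rw [min_eq_left h]
        · rw [min_eq_right h, take_length, take_of_length_le h]
      · refine ⟨(ω ++ v).length, ?_⟩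
        rw [take_length, cs.wordProd_append, hω, ← hvu, mul_inv_cancel_left]

end CayleyGraph

/-! ### Convexity of the metric in CAT(0) spaces. -/

section Comparison

theorem exists_comparison_triangle {D E F : ℝ} (hD : 0 ≤ D) (hE : 0 ≤ E) (hF : 0 ≤ F)
    (h1 : D ≤ E + F) (h2 : E ≤ D + F) (h3 : F ≤ D + E) :
    ∃ a b c : EuclideanSpace ℝ (Fin 2), dist a b = D ∧ dist a c = E ∧ dist b c = F := by
  rcases hD.eq_or_lt with rfl | hD
  · obtain rfl : E = F := by linarith
    refine ⟨!₂[0, 0], !₂[0, 0], !₂[E, 0], ?_, ?_, ?_⟩ <;>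
      simp [EuclideanSpace.dist_eq, Fin.sum_univ_two, Real.dist_eq, hE]
  -- By the law of cosines, `x` is the first coordinate of the third vertex; the triangle
  -- inequalities give `|x| ≤ E`.
  · set x := (D ^ 2 + E ^ 2 - F ^ 2) / (2 * D) with hx
    have hxD : 2 * D * x = D ^ 2 + E ^ 2 - F ^ 2 := by rw [hx]; field_simp
    have hxE : x ^ 2 ≤ E ^ 2 := by
      apply sq_le_sq.2
      rw [abs_of_nonneg hE, abs_le]
      constructor
      · by_contra hc
        push Not at hc
        nlinarith
      · by_contra hc
        push Not at hc
        nlinarith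
    have hy := Real.sq_sqrt (sub_nonneg.2 hxE)
    refine ⟨!₂[0, 0], !₂[D, 0], !₂[x, √(E ^ 2 - x ^ 2)], ?_, ?_, ?_⟩
    · simp [EuclideanSpace.dist_eq, Fin.sum_univ_two, Real.dist_eq, hD.le]
    · simp only [EuclideanSpace.dist_eq, Fin.sum_univ_two, Real.dist_eq, sq_abs]
      rw [Real.sqrt_eq_iff_eq_sq (by positivity) hE]
      simp [hy]
    · simp only [EuclideanSpace.dist_eq, Fin.sum_univ_two, Real.dist_eq, sq_abs]
      rw [Real.sqrt_eq_iff_eq_sq (by positivity) hF]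
      simp [hy]
      linarith

variable {X : Type*} [MetricSpace X]

theorem IsGeodesic.dist_eq {c : ℝ → X} {D : ℝ} {x y : X} (h : IsGeodesic c D x y) :
    dist x y = D := by
  rw [← h.source, ← h.target, h.isometric 0 ⟨le_rfl, h.nonneg⟩ D ⟨h.nonneg, le_rfl⟩, zero_sub,
    abs_neg, abs_of_nonneg h.nonneg]

theorem IsGeodesic.reverse {c : ℝ → X} {D : ℝ} {x y : X} (h : IsGeodesic c D x y) :
    IsGeodesic (fun t => c (D - t)) D y x where
  nonneg := h.nonneg
  source := by simp [h.target]
  target := by simp [h.source]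
  isometric t ht t' ht' := by
    rw [h.isometric _ ⟨by linarith [ht.2], by linarith [ht.1]⟩ _
      ⟨by linarith [ht'.2], by linarith [ht'.1]⟩, abs_sub_comm]
    congr 1
    ring

theorem IsGeodesic.of_Icc {c : ℝ → X} {D a b : ℝ}
    (h : ∀ t ∈ Set.Icc 0 D, ∀ t' ∈ Set.Icc 0 D, dist (c t) (c t') = |t - t'|)
    (ha : 0 ≤ a) (hab : a ≤ b) (hb : b ≤ D) :
    IsGeodesic (fun t => c (a + t)) (b - a) (c a) (c b) where
  nonneg := by linarith
  source := by simp
  target := by simp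
  isometric t ht t' ht' := by
    rw [h _ ⟨by linarith [ht.1], by linarith [ht.2]⟩ _
      ⟨by linarith [ht'.1], by linarith [ht'.2]⟩]
    congr 1
    ring

theorem IsGeodesic.smul {W : Type*} [Group W] [MulAction W X] [IsIsometricSMul W X]
    {c : ℝ → X} {D : ℝ} {x y : X} (h : IsGeodesic c D x y) (g : W) :
    IsGeodesic (fun t => g • c t) D (g • x) (g • y) where
  nonneg := h.nonneg
  source := by simp [h.source]
  target := by simp [h.target]
  isometric t ht t' ht' := by rw [dist_smul, h.isometric t ht t' ht']

theorem IsCAT0.dist_le_mul (hX : IsCAT0 X) {a b c : X} {γ η : ℝ → X} {D E : ℝ}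
    (hγ : IsGeodesic γ D a b) (hη : IsGeodesic η E a c) {l : ℝ} (hl : l ∈ Set.Icc (0 : ℝ) 1) :
    dist (γ (l * D)) (η (l * E)) ≤ l * dist b c := by
  obtain ⟨a', b', c', hab, hac, hbc⟩ := exists_comparison_triangle (D := dist a b)
    (E := dist a c) (F := dist b c) dist_nonneg dist_nonneg dist_nonneg
    (by linarith [dist_triangle a c b, dist_comm b c]) (dist_triangle a b c)
    (by linarith [dist_triangle b a c, dist_comm a b])
  have h := hX.comparison a b c γ η D E hγ hη a' b' c' hab hac hbc (l * D)
    ⟨mul_nonneg hl.1 hγ.nonneg, mul_le_of_le_one_left hγ.nonneg hl.2⟩ (l * E)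
    ⟨mul_nonneg hl.1 hη.nonneg, mul_le_of_le_one_left hη.nonneg hl.2⟩
    (AffineMap.lineMap a' b' l) (by rw [segment_eq_image_lineMap]; exact ⟨l, hl, rfl⟩)
    (AffineMap.lineMap a' c' l) (by rw [segment_eq_image_lineMap]; exact ⟨l, hl, rfl⟩)
    (by rw [dist_left_lineMap, hab, hγ.dist_eq, Real.norm_of_nonneg hl.1])
    (by rw [dist_left_lineMap, hac, hη.dist_eq, Real.norm_of_nonneg hl.1])
  refine h.trans_eq ?_
  rw [AffineMap.lineMap_apply, AffineMap.lineMap_apply, dist_vadd_cancel_right, dist_smul₀,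
    Real.norm_of_nonneg hl.1, vsub_eq_sub, vsub_eq_sub, dist_sub_right, hbc]

/-- The distance of two geodesics that are defined on the same interval is bounded by its values
at the endpoints. -/
theorem IsCAT0.dist_le_max (hX : IsCAT0 X) {a b a' b' : X} {γ η : ℝ → X} {D : ℝ}
    (hγ : IsGeodesic γ D a b) (hη : IsGeodesic η D a' b') {s : ℝ} (hs : s ∈ Set.Icc 0 D) :
    dist (γ s) (η s) ≤ max (dist a a') (dist b b') := by
  rcases hγ.nonneg.eq_or_lt with rfl | hD
  · obtain rfl : s = 0 := le_antisymm hs.2 hs.1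
    rw [hγ.source, hη.source]
    exact le_max_left _ _
  -- The diagonal `e` shares `a` with `γ` and `b'` with `η`. Comparing along it bounds the distance
  -- by the average of the endpoint distances with weights `1 - l` and `l`.
  obtain ⟨e, E, he⟩ := hX.geodesic a b'
  set l := s / D with hl
  have hlD : l * D = s := by rw [hl]; field_simp
  have hl0 : 0 ≤ l := div_nonneg hs.1 hD.le
  have hl1 : l ≤ 1 := (div_le_one hD).2 hs.2
  have h1 := hX.dist_le_mul hγ he ⟨hl0, hl1⟩
  have h2 := hX.dist_le_mul he.reverse hη.reverse (l := 1 - l) ⟨by linarith, by linarith⟩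
  simp only [sub_mul, one_mul, sub_sub_cancel, hlD] at h1 h2
  have h3 := dist_triangle (γ s) (e (l * E)) (η s)
  nlinarith [le_max_left (dist a a') (dist b b'), le_max_right (dist a a') (dist b b')]

/-- The displacement of an isometry along a geodesic is bounded by its values at the
endpoints. -/
theorem IsCAT0.displacement_le (hX : IsCAT0 X) {W : Type*} [Group W] [MulAction W X]
    [IsIsometricSMul W X] {c : ℝ → X} {D : ℝ}
    (h : ∀ t ∈ Set.Icc 0 D, ∀ t' ∈ Set.Icc 0 D, dist (c t) (c t') = |t - t'|)
    {a t b K : ℝ} (ha : 0 ≤ a) (hat : a ≤ t) (htb : t ≤ b) (hb : b ≤ D) (g : W)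
    (hKa : dist (c a) (g • c a) ≤ K) (hKb : dist (c b) (g • c b) ≤ K) :
    dist (c t) (g • c t) ≤ K := by
  have hc := IsGeodesic.of_Icc h ha (hat.trans htb) hb
  have := hX.dist_le_max hc (hc.smul g) (s := t - a) ⟨by linarith, by linarith⟩
  simp only [add_sub_cancel] at this
  exact this.trans (max_le hKa hKb)

end Comparison

/-! ### Orbit estimates for a geometric action. -/

section Action

variable {W X : Type*} [Group W] [MetricSpace X] [MulAction W X]

theorem IsGeometricAction.finite_setOf_dist_le (hW : IsGeometricAction W X) (hX : IsCAT0 X)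
    (x₀ : X) (r : ℝ) : {w : W | dist x₀ (w • x₀) ≤ r}.Finite := by
  have := hX.proper
  have := hW.properlyDiscontinuous
  refine (ProperlyDiscontinuousSMul.finite_disjoint_inter_image (Γ := W)
    (isCompact_singleton (x := x₀)) (isCompact_closedBall x₀ r)).subset fun w hw => ?_
  exact ⟨w • x₀, ⟨x₀, rfl, rfl⟩, by rw [Metric.mem_closedBall, dist_comm]; exact hw⟩

theorem IsGeometricAction.exists_dist_orbit_le (hW : IsGeometricAction W X) (x₀ : X) :
    ∃ R : ℝ, 0 ≤ R ∧ ∀ x : X, ∃ g : W, dist (g • x₀) x ≤ R := by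
  have := hW.isometric
  obtain ⟨K, hK, hcov⟩ := hW.cocompact
  obtain ⟨R, hR⟩ := hK.isBounded.subset_closedBall x₀
  refine ⟨max R 0, le_max_right _ _, fun x => ?_⟩
  obtain ⟨g, k, hk, rfl⟩ := hcov x
  refine ⟨g, ?_⟩
  rw [dist_smul, dist_comm]
  exact (hR hk).trans (le_max_left _ _)

variable {B : Type*} {M : CoxeterMatrix B} (cs : CoxeterSystem M W)

theorem exists_dist_simple_le [Finite B] (x₀ : X) :
    ∃ C : ℝ, 0 ≤ C ∧ ∀ i, dist x₀ (cs.simple i • x₀) ≤ C := by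
  obtain ⟨C, hC⟩ := (Set.finite_range fun i => dist x₀ (cs.simple i • x₀)).bddAbove
  exact ⟨max C 0, le_max_right _ _, fun i => (hC ⟨i, rfl⟩).trans (le_max_left _ _)⟩

theorem dist_smul_le_mul_length [IsIsometricSMul W X] {x₀ : X} {C : ℝ}
    (hC : ∀ i, dist x₀ (cs.simple i • x₀) ≤ C) (g h : W) :
    dist (g • x₀) (h • x₀) ≤ C * cs.length (g⁻¹ * h) := by
  have key : ∀ ω : List B, dist x₀ (cs.wordProd ω • x₀) ≤ C * ω.length := by
    intro ω
    induction ω with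
    | nil => simp
    | cons i ω ih =>
      have h1 := dist_triangle x₀ (cs.simple i • x₀) (cs.simple i • cs.wordProd ω • x₀)
      rw [dist_smul] at h1
      rw [cs.wordProd_cons, mul_smul, length_cons]
      push_cast
      linarith [hC i]
  obtain ⟨ω, hω, hgh⟩ := cs.exists_isReduced (g⁻¹ * h)
  have h1 := key ω
  rw [← hgh, ← hω.eq, ← hgh] at h1
  rwa [← dist_smul g, ← mul_smul, mul_inv_cancel_left] at h1

end Action

end RACG

/-! ### Tracking geodesics by reduced words, and the two conclusions. -/

namespace RACG

open List Filter

variable {B W X : Type*} [Group W] {M : CoxeterMatrix B} (cs : CoxeterSystem M W)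
variable [MetricSpace X] [MulAction W X]

/-- The wall crossed by a word at a given step displaces the vertex before that step by a bounded
amount. -/
theorem dist_getElem_leftInvSeq_smul_le [IsIsometricSMul W X] {x₀ : X} {C : ℝ}
    (hC : ∀ i, dist x₀ (cs.simple i • x₀) ≤ C) (ω : List B) (n : ℕ)
    (hn : n < (cs.leftInvSeq ω).length) :
    dist (cs.wordProd (ω.take n) • x₀)
      ((cs.leftInvSeq ω)[n] • cs.wordProd (ω.take n) • x₀) ≤ C := by
  rw [cs.length_leftInvSeq] at hn
  rw [cs.getElem_leftInvSeq ω n hn, ← mul_smul, inv_mul_cancel_right, mul_smul, dist_smul]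
  exact hC _

theorem displacement_triangle [IsIsometricSMul W X] (t : W) (x y : X) :
    dist x (t • x) ≤ dist y (t • y) + 2 * dist x y := by
  have h1 := dist_triangle4 x y (t • y) (t • x)
  rw [dist_smul, dist_comm y x] at h1
  linarith

/-- Along a word that follows a geodesic, only boundedly many walls are crossed both before and
after a given step. -/
theorem ncard_crossed_twice_le (hX : IsCAT0 X) [IsIsometricSMul W X] {x₀ : X} {C R : ℝ}
    (hC : ∀ i, dist x₀ (cs.simple i • x₀) ≤ C)
    (hfin : {w : W | dist x₀ (w • x₀) ≤ C + 4 * R}.Finite)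
    {c : ℝ → X} {D : ℝ}
    (hc : ∀ t ∈ Set.Icc 0 D, ∀ t' ∈ Set.Icc 0 D, dist (c t) (c t') = |t - t'|)
    {ω : List B} {τ : ℕ → ℝ} (hτ : Monotone τ) (hτD : ∀ k, τ k ∈ Set.Icc 0 D)
    (hR : ∀ k, dist (cs.wordProd (ω.take k) • x₀) (c (τ k)) ≤ R) (k : ℕ) :
    {t | t ∈ (cs.leftInvSeq ω).take k ∧ t ∈ (cs.leftInvSeq ω).drop k}.ncard ≤
      {w : W | dist x₀ (w • x₀) ≤ C + 4 * R}.ncard := by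
  set p := cs.wordProd (ω.take k) with hp
  -- Conjugating by the vertex `p` moves the count to the base point, making the bound independent
  -- of `k`.
  refine Set.ncard_le_ncard_of_injOn (fun t => p⁻¹ * t * p) ?_ ?_ hfin
  · rintro t ⟨h1, h2⟩
    have hdisp : ∀ n (hn : n < (cs.leftInvSeq ω).length), (cs.leftInvSeq ω)[n] = t →
        dist (c (τ n)) (t • c (τ n)) ≤ C + 2 * R := by
      rintro n hn rfl
      have h3 := dist_getElem_leftInvSeq_smul_le cs hC ω n hn
      have h4 := displacement_triangle (cs.leftInvSeq ω)[n] (c (τ n))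
        (cs.wordProd (ω.take n) • x₀)
      have h5 := hR n
      rw [dist_comm] at h5
      linarith
    obtain ⟨a, ha, hat⟩ := mem_take_iff_getElem.1 h1
    obtain ⟨b, hb, hbt⟩ := mem_drop_iff_getElem.1 h2
    -- The wall is crossed at a step `a < k` and at a step `k + b`; displacement is convex in
    -- between.
    have h3 : dist (c (τ k)) (t • c (τ k)) ≤ C + 2 * R :=
      hX.displacement_le hc (hτD a).1 (hτ (by omega)) (hτ (Nat.le_add_right k b)) (hτD _).2 t
        (hdisp a (by omega) hat) (hdisp (k + b) (by omega) hbt)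
    have h4 := displacement_triangle t (p • x₀) (c (τ k))
    have h5 := hR k
    rw [← hp] at h5
    rw [Set.mem_ofPred_eq, ← dist_smul p, ← mul_smul]
    have h6 : p * (p⁻¹ * t * p) = t * p := by group
    rw [h6, mul_smul]
    linarith
  · intro a _ b _ h
    exact mul_left_cancel (mul_right_cancel h)

/-- Geodesics of `X` between points near the orbit of `x₀` are uniformly close to reduced
words. -/
theorem exists_isReduced_tracking [Finite B] (hM : IsRightAngled M) (hX : IsCAT0 X)
    (hW : IsGeometricAction W X) (x₀ : X) {R : ℝ} (hR0 : 0 ≤ R)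
    (hR : ∀ x : X, ∃ g : W, dist (g • x₀) x ≤ R) :
    ∃ δ : ℝ, 0 < δ ∧ ∀ (c : ℝ → X) (D : ℝ) (g : W), 0 ≤ D →
      (∀ t ∈ Set.Icc 0 D, ∀ t' ∈ Set.Icc 0 D, dist (c t) (c t') = |t - t'|) →
      dist x₀ (c 0) ≤ R → dist (g • x₀) (c D) ≤ R →
      ∃ ω : List B, cs.IsReduced ω ∧ cs.wordProd ω = g ∧
        (∀ k, ∃ t ∈ Set.Icc 0 D, dist (cs.wordProd (ω.take k) • x₀) (c t) ≤ δ) ∧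
        ∀ t ∈ Set.Icc 0 D, ∃ k, dist (cs.wordProd (ω.take k) • x₀) (c t) ≤ δ := by
  have := hW.isometric
  obtain ⟨C, hC0, hC⟩ := exists_dist_simple_le cs x₀
  -- Consecutive samples are at most `2 * R + 1` apart: two errors `R` and a unit step.
  obtain ⟨L, hL⟩ := ((hW.finite_setOf_dist_le hX x₀ (2 * R + 1)).image cs.length).bddAbove
  have hfin := hW.finite_setOf_dist_le hX x₀ (C + 4 * (C * L + R))
  set N := {w : W | dist x₀ (w • x₀) ≤ C + 4 * (C * L + R)}.ncard
  -- The summands are the cost of reducing the word, the distance of the interpolating word from the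
  -- geodesic, and the rounding of times to integers.
  refine ⟨C * N + (C * L + R) + 1, by positivity, fun c D g hD hc h0 hg => ?_⟩
  let θ : ℕ → ℝ := fun i => min i D
  have hθ : ∀ i, θ i ∈ Set.Icc 0 D := fun i => ⟨le_min i.cast_nonneg hD, min_le_right _ _⟩
  have hθm : Monotone θ := fun i j hij => min_le_min_right _ (Nat.cast_le.2 hij)
  choose f hf using fun i => hR (c (θ i))
  -- The added `1` keeps `u 0 = 1` and `u m = g` compatible when `D = 0`.
  set m := ⌈D⌉₊ + 1 with hm
  let u : ℕ → W := fun i => if i = 0 then 1 else if m ≤ i then g else f i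
  have hu0 : u 0 = 1 := if_pos rfl
  have hum : u m = g := by simp [u, hm]
  have hu : ∀ i, dist (u i • x₀) (c (θ i)) ≤ R := by
    intro i
    simp only [u]
    split_ifs with h1 h2
    · subst h1
      simpa [θ, hD] using h0
    · have : θ i = D := min_eq_right ((Nat.le_ceil D).trans (Nat.cast_le.2 (by omega)))
      rwa [this]
    · exact hf i
  have hstep : ∀ i, cs.length ((u i)⁻¹ * u (i + 1)) ≤ L := by
    intro i
    refine hL ⟨_, ?_, rfl⟩
    rw [Set.mem_ofPred_eq, ← dist_smul (u i), ← mul_smul, mul_inv_cancel_left]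
    have h1 := dist_triangle4 (u i • x₀) (c (θ i)) (c (θ (i + 1))) (u (i + 1) • x₀)
    have h2 : dist (c (θ i)) (c (θ (i + 1))) ≤ 1 := by
      rw [hc _ (hθ _) _ (hθ _), abs_sub_comm]
      refine (abs_min_sub_min_le_max _ _ _ _).trans ?_
      simp
    have h3 := hu (i + 1)
    rw [dist_comm] at h3
    linarith [hu i]
  obtain ⟨ω, σ, hω, hσ, -, hσL, hs⟩ := exists_word_interpolating cs hu0 hstep m
  have hRω : ∀ k, dist (cs.wordProd (ω.take k) • x₀) (c (θ (σ k))) ≤ C * L + R := by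
    intro k
    have h1 := dist_smul_le_mul_length cs hC (cs.wordProd (ω.take k)) (u (σ k))
    have h2 : (cs.length ((cs.wordProd (ω.take k))⁻¹ * u (σ k)) : ℝ) ≤ L :=
      Nat.cast_le.2 (hσL k)
    have h3 := mul_le_mul_of_nonneg_left h2 hC0
    linarith [dist_triangle (cs.wordProd (ω.take k) • x₀) (u (σ k) • x₀) (c (θ (σ k))),
      hu (σ k)]
  have hN : ∀ k, _ ≤ N := ncard_crossed_twice_le cs hX hC hfin hc (hθm.comp hσ)
    (fun k => hθ (σ k)) hRω
  obtain ⟨ω', hp, hred, h1, h2⟩ := exists_isReduced_near cs hM ω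
  have hclose : ∀ {k k' : ℕ},
      cs.length ((cs.wordProd (ω.take k))⁻¹ * cs.wordProd (ω'.take k')) ≤
        {t | t ∈ (cs.leftInvSeq ω).take k ∧ t ∈ (cs.leftInvSeq ω).drop k}.ncard →
      dist (cs.wordProd (ω'.take k') • x₀) (cs.wordProd (ω.take k) • x₀) ≤ C * N := by
    intro k k' h
    rw [dist_comm]
    exact (dist_smul_le_mul_length cs hC _ _).trans
      (mul_le_mul_of_nonneg_left (Nat.cast_le.2 (h.trans (hN k))) hC0)
  refine ⟨ω', hred, by rw [hp, hω, hum], fun k' => ?_, fun t ht => ?_⟩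
  · obtain ⟨k, hk⟩ := h2 k'
    refine ⟨θ (σ k), hθ _, ?_⟩
    linarith [hclose hk, hRω k, dist_triangle (cs.wordProd (ω'.take k') • x₀)
      (cs.wordProd (ω.take k) • x₀) (c (θ (σ k)))]
  · have hfl : ⌊t⌋₊ ≤ m := by
      have : ⌊t⌋₊ ≤ ⌈D⌉₊ := (Nat.floor_mono ht.2).trans (Nat.floor_le_ceil D)
      omega
    obtain ⟨k, hk⟩ := hs _ hfl
    obtain ⟨k', hk'⟩ := h1 k
    refine ⟨k', ?_⟩
    have h3 : θ ⌊t⌋₊ = ⌊t⌋₊ := min_eq_left ((Nat.floor_le ht.1).trans ht.2)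
    have h4 : dist (c (θ ⌊t⌋₊)) (c t) ≤ 1 := by
      rw [hc _ (hθ _) _ ht, h3, abs_sub_comm, abs_of_nonneg (sub_nonneg.2 (Nat.floor_le ht.1))]
      linarith [Nat.lt_floor_add_one t]
    have h5 := hu ⌊t⌋₊
    rw [← hk] at h5
    have h6 : 0 ≤ C * L := by positivity
    linarith [hclose hk', dist_triangle4 (cs.wordProd (ω'.take k') • x₀)
      (cs.wordProd (ω.take k) • x₀) (c (θ ⌊t⌋₊)) (c t)]

/-- A sequence in a finite set is frequently constant along an ultrafilter. -/
theorem exists_eventually_eq {ι α : Type*} (U : Ultrafilter ι) {s : Set α} (hs : s.Finite)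
    {f : ι → α} (hf : ∀ i, f i ∈ s) : ∃ a, ∀ᶠ i in (U : Filter ι), f i = a := by
  obtain ⟨a, -, ha⟩ := (Ultrafilter.finite_biUnion_mem_iff (f := U) hs
    (s := fun a => {i | f i = a})).1 (Filter.mem_of_superset Filter.univ_mem fun i _ =>
      Set.mem_biUnion (hf i) rfl)
  exact ⟨a, ha⟩

theorem length_take_inv_mul_take {ω : List B} (hω : cs.IsReduced ω) {n k : ℕ}
    (h : n + k ≤ ω.length) :
    cs.length ((cs.wordProd (ω.take n))⁻¹ * cs.wordProd (ω.take (n + k))) = k := by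
  have h1 : ω.take (n + k) = ω.take n ++ (ω.drop n).take k := take_add
  rw [h1, cs.wordProd_append, inv_mul_cancel_left, ((hω.drop n).take k).eq, length_take,
    length_drop]
  omega

theorem exists_cayleyRay_tracks [Finite B] (hM : IsRightAngled M) (hX : IsCAT0 X)
    (hW : IsGeometricAction W X) (x₀ : X) :
    ∃ δ : ℝ, 0 < δ ∧ ∀ r : ℝ → X, IsGeodesicRay r x₀ →
      ∃ α : ℕ → W, IsCayleyRay cs α ∧ α 0 = 1 ∧ Tracks x₀ δ α r := by
  have := hW.isometric
  obtain ⟨R, hR0, hR⟩ := hW.exists_dist_orbit_le x₀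
  obtain ⟨C, hC0, hC⟩ := exists_dist_simple_le cs x₀
  obtain ⟨δ, hδ, htrack⟩ := exists_isReduced_tracking cs hM hX hW x₀ hR0 hR
  -- Vertices are within `δ` of the ray, and points of an edge are within `C` of a vertex.
  refine ⟨δ + C, by positivity, fun r hr => ?_⟩
  choose g hg using fun K : ℕ => hR (r K)
  have hiso : ∀ K : ℕ, ∀ t ∈ Set.Icc (0 : ℝ) K, ∀ t' ∈ Set.Icc (0 : ℝ) K,
      dist (r t) (r t') = |t - t'| := fun K t ht t' ht' => hr.isometric t ht.1 t' ht'.1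
  choose ω hred hprod hnear _ using fun K : ℕ => htrack r K (g K) K.cast_nonneg (hiso K)
    (by rwa [hr.source, dist_self]) (hg K)
  have hlen : ∀ n : ℕ, ∀ᶠ K in atTop, n ≤ (ω K).length := by
    intro n
    obtain ⟨K₀, hK₀⟩ := exists_nat_gt (C * n + R)
    filter_upwards [eventually_ge_atTop K₀] with K hK
    by_contra! hlt
    have h1 : dist x₀ (r K) = K := by
      have := hr.isometric 0 (Set.mem_Ici.2 le_rfl) K (Set.mem_Ici.2 K.cast_nonneg)
      rw [hr.source] at this
      simpa using this
    have h2 := dist_smul_le_mul_length cs hC 1 (g K)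
    rw [one_smul, inv_one, one_mul, ← hprod K, (hred K).eq, hprod K] at h2
    have h3 : C * (ω K).length ≤ C * n :=
      mul_le_mul_of_nonneg_left (Nat.cast_le.2 hlt.le) hC0
    have h4 : (K₀ : ℝ) ≤ K := Nat.cast_le.2 hK
    linarith [hg K, dist_triangle x₀ (g K • x₀) (r K)]
  let U : Ultrafilter ℕ := hyperfilter ℕ
  have hU : (U : Filter ℕ) ≤ atTop := Nat.hyperfilter_le_atTop
  have hex : ∀ n, ∃ a, ∀ᶠ K in (U : Filter ℕ), cs.wordProd ((ω K).take n) = a := by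
    intro n
    -- Prefixes of length at most `n` represent finitely many elements, so the ultrafilter selects
    -- one for each `n`. These choices are compatible because finitely many of them hold
    -- simultaneously for some `K`.
    refine exists_eventually_eq U (hW.finite_setOf_dist_le hX x₀ (C * n)) fun K => ?_
    have h2 := dist_smul_le_mul_length cs hC 1 (cs.wordProd ((ω K).take n))
    rw [one_smul, inv_one, one_mul] at h2
    refine h2.trans (mul_le_mul_of_nonneg_left (Nat.cast_le.2 ?_) hC0)
    exact (cs.length_wordProd_le _).trans (length_take_le _ _)
  choose α hα using hex
  have hray : ∀ n k, cs.length ((α n)⁻¹ * α (n + k)) = k := by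
    intro n k
    obtain ⟨K, h1, h2, h3⟩ := ((hα n).and ((hα (n + k)).and (hU (hlen (n + k))))).exists
    rw [← h1, ← h2]
    exact length_take_inv_mul_take cs (hred K) h3
  have h0 : α 0 = 1 := by
    obtain ⟨K, h1⟩ := (hα 0).exists
    rw [← h1, take_zero, cs.wordProd_nil]
  refine ⟨α, fun n k => by rw [cayleyGraph_dist, hray], h0, ?_, ?_⟩
  · rintro p ⟨n, c, D, hc, t, ht, rfl⟩
    obtain ⟨K, h1⟩ := (hα n).exists
    obtain ⟨s, hs, hsd⟩ := hnear K n
    refine ⟨s, hs.1, ?_⟩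
    rw [h1] at hsd
    have h2 : dist (c t) (α n • x₀) ≤ C := by
      rw [← hc.source, hc.isometric t ht 0 ⟨le_rfl, hc.nonneg⟩, sub_zero, abs_of_nonneg ht.1]
      refine ht.2.trans ?_
      rw [← hc.dist_eq]
      refine (dist_smul_le_mul_length cs hC _ _).trans_eq ?_
      rw [hray n 1, Nat.cast_one, mul_one]
    linarith [dist_triangle (c t) (α n • x₀) (r s)]
  · rw [hr.source, h0, one_smul, dist_self]
    positivity

theorem isQuasiConvex_specialSubgroup_orbit [Finite B] (hM : IsRightAngled M) (hX : IsCAT0 X)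
    (hW : IsGeometricAction W X) (x₀ : X) (A : Set B) :
    IsQuasiConvex {p : X | ∃ g ∈ specialSubgroup cs A, g • x₀ = p} := by
  have := hW.isometric
  obtain ⟨R, hR0, hR⟩ := hW.exists_dist_orbit_le x₀
  obtain ⟨δ, hδ, htrack⟩ := exists_isReduced_tracking cs hM hX hW x₀ hR0 hR
  refine ⟨δ, hδ.le, ?_⟩
  rintro _ ⟨g, hg, rfl⟩ _ ⟨h, hh, rfl⟩ _ ⟨c, D, hc, t, ht, rfl⟩
  -- Translating by `g⁻¹` makes the geodesic start at `x₀` and end at the orbit point of an element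
  -- of `⟨A⟩`.
  have hc' := hc.smul g⁻¹
  obtain ⟨ω, hred, hprod, -, hnear⟩ := htrack _ D (g⁻¹ * h) hc.nonneg hc'.isometric
    (by rwa [hc'.source, inv_smul_smul, dist_self])
    (by rwa [hc'.target, mul_smul, dist_self])
  obtain ⟨k, hk⟩ := hnear t ht
  have hA := mem_of_mem_isReduced cs hM hred (A := A)
    (by rw [hprod]; exact mul_mem (inv_mem hg) hh)
  refine ⟨_, ⟨g * cs.wordProd (ω.take k), mul_mem hg
    (wordProd_mem_specialSubgroup cs fun a ha => hA a (mem_of_mem_take ha)), rfl⟩, ?_⟩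
  rwa [dist_comm, mul_smul, ← dist_smul g⁻¹, inv_smul_smul]

end RACG

theorem lemma4p1 {B W X : Type*} [Finite B] [Group W] {M : CoxeterMatrix B}
    (cs : CoxeterSystem M W) (hM : RACG.IsRightAngled M)
    [MetricSpace X] [MulAction W X] (hX : RACG.IsCAT0 X) (hW : RACG.IsGeometricAction W X)
    (x₀ : X) :
    (∃ δ : ℝ, 0 < δ ∧ ∀ r : ℝ → X, RACG.IsGeodesicRay r x₀ →
      ∃ α : ℕ → W, RACG.IsCayleyRay cs α ∧ α 0 = 1 ∧ RACG.Tracks x₀ δ α r) ∧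
    ∀ A : Set B,
      RACG.IsQuasiConvex {p : X | ∃ g ∈ RACG.specialSubgroup cs A, g • x₀ = p} :=
  ⟨RACG.exists_cayleyRay_tracks cs hM hX hW x₀,
    RACG.isQuasiConvex_specialSubgroup_orbit cs hM hX hW x₀⟩
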